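/- Let $\alpha,v,w>0$ be real. Let $\zeta_2(s,\alpha;v,w)$ be the Barnes double zeta function, that is, the analytic continuation to $\mathbb{C}\setminus\{1,2\}$ of $\sum_{m,n\ge 0}(\alpha+mv+nw)^{-s}$ ($\operatorname{Re}s>2$). This continuation exists. Write $\zeta_2^{(k)}(0,\alpha;v,w)$ for its $k$-th derivative with respect to $s$ at $s=0$. For $c\in\{1,2\}$ let $\gamma_k(c,\alpha;v,w)$ be the coefficients of its Laurent expansion at $s=c$, $$\zeta_2(s,\alpha;v,w)=\sum_{k=-1}^{\infty}\gamma_k(c,\alpha;v,w)(s-c)^k\qquad(0<|s-c|<1),$$ which has no terms of order below $-1$. Put $\log\Gamma_2(\alpha;v,w)=\zeta_2'(0,\alpha;v,w)$, so that $\Gamma_2(\alpha;v,w)=\exp(\zeta_2'(0,\alpha;v,w))$, where $\zeta_2'(0,\alpha;v,w)$ is the principal logarithm of $\Gamma_2(\alpha;v,w)$, and $\psi_2^{(k)}(\alpha;v,w)=\frac{\partial^k}{\partial\alpha^k}\log\Gamma_2(\alpha;v,w)$ for $k\ge 0$. All the derivatives with respect to $\alpha$ below exist, and the following hold. (1) For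 every integer $k\ge 0$, $$\gamma_{k-1}(1,\alpha;v,w)=-\frac1{k!}\frac{\partial}{\partial\alpha}\zeta_2^{(k)}(0,\alpha;v,w).$$ In particular $\gamma_{-1}(1,\alpha;v,w)=\dfrac{v+w-2\alpha}{2vw}$ and $\gamma_0(1,\alpha;v,w)=-\dfrac{\partial}{\partial\alpha}\log\Gamma_2(\alpha;v,w)$; moreover, for every integer $k\ge0$, $$\frac{\partial^k}{\partial\alpha^k}\gamma_0(1,\alpha;v,w)=-\frac{\partial}{\partial\alpha}\psi_2^{(k)}(\alpha;v,w).$$ (2) For every integer $k\ge -1$, $$\sum_{l=-1}^{k}(-1)^{k-l+1}\frac{\partial}{\partial\alpha}\gamma_l(1,\alpha;v,w)=\gamma_k(2,\alpha;v,w).$$ -/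

import Mathlib

/-- `Z` is the analytic continuation to `ℂ \ {1, 2}` of the double series
`∑_{m,n ≥ 0} (α + m v + n w)^{-s}`, `Re s > 2`. Such a `Z` is unique off `{1, 2}`, because
`ℂ \ {1, 2}` is connected. -/
def IsBarnesContinuation (α v w : ℝ) (Z : ℂ → ℂ) : Prop :=
  DifferentiableOn ℂ Z {1, 2}ᶜ ∧
    ∀ s : ℂ, 2 < s.re →
      HasSum (fun p : ℕ × ℕ => 1 / ((α + p.1 * v + p.2 * w : ℝ) : ℂ) ^ s) (Z s)

open Classical in
/-- The Barnes double zeta function `ζ₂(s, α; v, w)`, analytically continued in `s`.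
Its values at `s = 1, 2` have no meaning and are never used. -/
noncomputable def barnesZeta (s : ℂ) (α v w : ℝ) : ℂ :=
  if h : ∃ Z : ℂ → ℂ, IsBarnesContinuation α v w Z then h.choose s else 0

/-- The `k`-th Laurent coefficient `γ_k(c, α; v, w)` of `s ↦ ζ₂(s, α; v, w)` at `c` (`c = 1, 2`),
`(2πi)⁻¹ ∮ ζ₂(s) (s - c)^{-k-1} ds`. The circle `|s - c| = 1/2` lies in the punctured disc
`0 < |s - c| < 1`, where `ζ₂` is holomorphic. -/
noncomputable def barnesGamma (k : ℤ) (c : ℂ) (α v w : ℝ) : ℂ :=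
  (2 * Real.pi * Complex.I)⁻¹ *
    ∮ s in C(c, 1 / 2), barnesZeta s α v w / (s - c) ^ (k + 1)

/-- The `k`-th derivative in `s` at `s = 0`, `ζ₂^{(k)}(0, α; v, w)`. -/
noncomputable def barnesZetaDerivZero (k : ℕ) (α v w : ℝ) : ℂ :=
  iteratedDeriv k (fun s : ℂ => barnesZeta s α v w) 0

/-- `log Γ₂(x; v, w) := ζ₂'(0, x; v, w)`. -/
noncomputable def logDoubleGamma (x v w : ℝ) : ℂ :=
  deriv (fun s : ℂ => barnesZeta s x v w) 0

/-- The double gamma function `Γ₂(x; v, w) = exp (ζ₂'(0, x; v, w))`. -/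
noncomputable def doubleGamma (x v w : ℝ) : ℂ :=
  Complex.exp (logDoubleGamma x v w)

/-- The double polygamma function `ψ₂^{(k)}(x; v, w) = (d/dx)^k log Γ₂(x; v, w)`. -/
noncomputable def doublePolygamma (k : ℕ) (x v w : ℝ) : ℂ :=
  iteratedDeriv k (fun y : ℝ => logDoubleGamma y v w) x

/-! A function `F s x` of Barnes zeta type, `x` being its first parameter, obeys a ladder relation
`∂F/∂x (s, x) = (c - s) F (s + 1, x)`. Multiplying the Barnes series of order `d` by
`(s - 1) ⋯ (s - d)` removes its poles, and Taylor's formula from `x` to `x + w`, whose increment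
telescopes to the series of order `d - 1`, writes the product at `s` as a term already known to be
entire plus an average of the product at `s + 1`. This continues the product to the whole plane one
unit strip at a time, and gives its value at `s = 1`.

Differentiating the contour integrals for the Laurent coefficients of `ζ₂` at `n` under the integral
sign and shifting the contour by `1` expresses the derivatives through the coefficients at `n + 1`.
For `n = 0` these are the formulas for `γ_k(1)`. For `n = 1` one finds
`∂γ_l(1)/∂α = -γ_l(2) - γ_{l-1}(2)`, and the alternating sum telescopes because `γ_{-2}(2) = 0`. -/

open Set Filter Topology Metric MeasureTheory

section ParametricIntegrals

variable {E : Type*} [NormedAddCommGroup E] {a b : ℝ}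

theorem continuousOn_intervalIntegral_of_continuousOn [NormedSpace ℝ E] {X : Type*}
    [TopologicalSpace X] {S : Set X} (hab : a ≤ b) {f : X → ℝ → E}
    (hf : ContinuousOn (Function.uncurry f) (S ×ˢ Icc a b)) :
    ContinuousOn (fun p => ∫ t in a..b, f p t) S := by
  have hproj : Continuous (Function.uncurry fun (p : S) (t : ℝ) => f p (projIcc a b hab t)) :=
    hf.comp_continuous (f := fun q : S × ℝ => ((q.1 : X), (projIcc a b hab q.2 : ℝ)))
      (by fun_prop) fun q => ⟨q.1.2, (projIcc a b hab q.2).2⟩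
  rw [continuousOn_iff_continuous_domRestrict]
  refine (intervalIntegral.continuous_parametric_intervalIntegral_of_continuous' (μ := volume)
    hproj a b).congr fun p => intervalIntegral.integral_congr fun t ht => ?_
  rw [uIcc_of_le hab] at ht
  simp only [projIcc_of_mem hab ht]

theorem hasDerivAt_intervalIntegral_of_continuousOn [NormedSpace ℝ E] {S : Set ℝ} (hS : IsOpen S)
    (hab : a ≤ b) {f f' : ℝ → ℝ → E} (hf : ∀ x ∈ S, ContinuousOn (f x) (Icc a b))
    (hf' : ContinuousOn (Function.uncurry f') (S ×ˢ Icc a b))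
    (hd : ∀ x ∈ S, ∀ t ∈ Icc a b, HasDerivAt (fun y => f y t) (f' x t) x) {x₀ : ℝ}
    (hx₀ : x₀ ∈ S) :
    HasDerivAt (fun x => ∫ t in a..b, f x t) (∫ t in a..b, f' x₀ t) x₀ := by
  obtain ⟨K, hK, hxK, hKS⟩ := exists_compact_subset hS hx₀
  obtain ⟨M, hM⟩ := (hK.prod isCompact_Icc).exists_bound_of_continuousOn
    (hf'.mono (prod_mono hKS (subset_refl (Icc a b))))
  have hsub : uIoc a b ⊆ Icc a b := by rw [uIoc_of_le hab]; exact Ioc_subset_Icc_self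
  have hf'₀ : ContinuousOn (f' x₀) (Icc a b) :=
    hf'.comp (f := fun t => (x₀, t)) (by fun_prop) fun t ht => ⟨hx₀, ht⟩
  refine (intervalIntegral.hasDerivAt_integral_of_dominated_loc_of_deriv_le
    (s := interior K) (bound := fun _ => M) (isOpen_interior.mem_nhds hxK) ?_ ?_ ?_ ?_
    intervalIntegrable_const ?_).2
  · filter_upwards [hS.mem_nhds hx₀] with x hx
    exact ((hf x hx).mono hsub).aestronglyMeasurable measurableSet_uIoc
  · exact (by rw [uIcc_of_le hab]; exact hf x₀ hx₀ : ContinuousOn _ (uIcc a b)).intervalIntegrable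
  · exact (hf'₀.mono hsub).aestronglyMeasurable measurableSet_uIoc
  · exact ae_of_all _ fun t ht x hx => hM (x, t) ⟨interior_subset hx, hsub ht⟩
  · exact ae_of_all _ fun t ht x hx => hd x (hKS (interior_subset hx)) t (hsub ht)

variable [NormedSpace ℂ E]

theorem circleIntegral_intervalIntegral_swap {c : ℂ} {R : ℝ} (hR : 0 ≤ R) (hab : a ≤ b)
    {f : ℂ → ℝ → E} (hf : ContinuousOn (Function.uncurry f) (sphere c R ×ˢ Icc a b)) :
    (∮ z in C(c, R), ∫ t in a..b, f z t) = ∫ t in a..b, ∮ z in C(c, R), f z t := by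
  simp only [circleIntegral, ← intervalIntegral.integral_smul]
  refine intervalIntegral_intervalIntegral_swap (IntegrableOn.mono_set (t := Icc 0 (2 * Real.pi) ×ˢ
    Icc a b) (ContinuousOn.integrableOn_compact (isCompact_Icc.prod isCompact_Icc) ?_) ?_)
  · simp only [Function.uncurry_def, deriv_circleMap]
    refine ContinuousOn.smul (by fun_prop) ?_
    exact hf.comp (f := fun q : ℝ × ℝ => (circleMap c R q.1, q.2)) (by fun_prop)
      fun q hq => ⟨circleMap_mem_sphere c hR q.1, hq.2⟩
  · rw [uIoc_of_le Real.two_pi_pos.le, uIoc_of_le hab]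
    exact prod_mono Ioc_subset_Icc_self Ioc_subset_Icc_self

theorem hasDerivAt_circleIntegral_of_continuousOn {c : ℂ} {R : ℝ} (hR : 0 ≤ R) {S : Set ℝ}
    (hS : IsOpen S) {f f' : ℂ → ℝ → E} (hf : ∀ x ∈ S, ContinuousOn (fun z => f z x) (sphere c R))
    (hf' : ContinuousOn (Function.uncurry f') (sphere c R ×ˢ S))
    (hd : ∀ z ∈ sphere c R, ∀ x ∈ S, HasDerivAt (f z) (f' z x) x) {x₀ : ℝ} (hx₀ : x₀ ∈ S) :
    HasDerivAt (fun x => ∮ z in C(c, R), f z x) (∮ z in C(c, R), f' z x₀) x₀ := by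
  have hmem : ∀ θ, circleMap c R θ ∈ sphere c R := circleMap_mem_sphere c hR
  simp only [circleIntegral, deriv_circleMap]
  refine hasDerivAt_intervalIntegral_of_continuousOn hS Real.two_pi_pos.le
    (f' := fun x θ => (circleMap 0 R θ * Complex.I) • f' (circleMap c R θ) x) ?_ ?_ ?_ hx₀
  · intro x hx
    exact ContinuousOn.smul (by fun_prop)
      ((hf x hx).comp (continuous_circleMap c R).continuousOn fun θ _ => hmem θ)
  · refine ContinuousOn.smul (by fun_prop) ?_
    exact hf'.comp (f := fun q : ℝ × ℝ => (circleMap c R q.2, q.1)) (by fun_prop)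
      fun q hq => ⟨hmem q.2, hq.1⟩
  · exact fun x hx θ _ => (hd _ (hmem θ) x hx).const_smul _

-- By Fubini the integral satisfies the Cauchy integral formula, hence is analytic.
theorem differentiableOn_intervalIntegral_of_continuousOn [CompleteSpace E] {U : Set ℂ}
    (hU : IsOpen U) (hab : a ≤ b) {f : ℂ → ℝ → E}
    (hf : ContinuousOn (Function.uncurry f) (U ×ˢ Icc a b))
    (hd : ∀ t ∈ Icc a b, DifferentiableOn ℂ (fun s => f s t) U) :
    DifferentiableOn ℂ (fun s => ∫ t in a..b, f s t) U := by
  intro c hc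
  obtain ⟨R, hR, hRU⟩ := nhds_basis_closedBall.mem_iff.1 (hU.mem_nhds hc)
  lift R to NNReal using hR.le
  have hsphere : sphere c R ⊆ U := sphere_subset_closedBall.trans hRU
  have hint : CircleIntegrable (fun s => ∫ t in a..b, f s t) c R :=
    ((continuousOn_intervalIntegral_of_continuousOn hab hf).mono hsphere).circleIntegrable hR.le
  refine DifferentiableAt.differentiableWithinAt (DifferentiableOn.differentiableAt (s := ball c R)
    ?_ (ball_mem_nhds c hR))
  have hana := (hasFPowerSeriesOn_cauchy_integral hint hR).differentiableOn
  rw [Metric.eball_coe] at hana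
  refine hana.congr fun s hs => ?_
  have hne : ∀ z ∈ sphere c (R : ℝ), z - s ≠ 0 := fun z hz h =>
    (mem_ball.1 hs).ne (by rw [← sub_eq_zero.1 h]; exact mem_sphere.1 hz)
  have hcauchy : ∀ t ∈ Icc a b,
      f s t = (2 * Real.pi * Complex.I : ℂ)⁻¹ • ∮ z in C(c, R), (z - s)⁻¹ • f z t := fun t ht => by
    rw [DifferentiableOn.circleIntegral_sub_inv_smul ((hd t ht).mono hRU) hs,
      inv_smul_smul₀ Complex.two_pi_I_ne_zero]
  simp only [← intervalIntegral.integral_smul]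
  rw [circleIntegral_intervalIntegral_swap hR.le hab, ← intervalIntegral.integral_smul]
  · exact intervalIntegral.integral_congr fun t ht => hcauchy t (by rwa [uIcc_of_le hab] at ht)
  · refine ContinuousOn.smul (ContinuousOn.inv₀ (by fun_prop) fun q hq => hne q.1 hq.1) ?_
    exact hf.mono (prod_mono hsphere subset_rfl)

end ParametricIntegrals

section HalfPlanes

theorem isOpen_re_gt (σ : ℝ) : IsOpen {s : ℂ | σ < s.re} :=
  isOpen_lt continuous_const Complex.continuous_re

theorem eqOn_of_eqOn_re_gt {E : Type*} [NormedAddCommGroup E] [NormedSpace ℂ E] [CompleteSpace E]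
    {U : Set ℂ} {f g : ℂ → E} {τ : ℝ} (hU : IsOpen U) (hUc : IsPreconnected U)
    (hUτ : ∃ s ∈ U, τ < s.re) (hf : DifferentiableOn ℂ f U) (hg : DifferentiableOn ℂ g U)
    (hfg : ∀ s, τ < s.re → f s = g s) : EqOn f g U := by
  obtain ⟨s, hsU, hs⟩ := hUτ
  exact (hf.analyticOnNhd hU).eqOn_of_preconnected_of_eventuallyEq (hg.analyticOnNhd hU) hUc hsU
    (eventually_of_mem ((isOpen_re_gt τ).mem_nhds hs) hfg)

end HalfPlanes

section RampAverage

variable {v x : ℝ} {f f' f'' : ℝ → ℂ}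

/-- The remainder of the first-order Taylor expansion of a function with second derivative `f` from
`x` to `x + v`, divided by `v`. -/
noncomputable def rampAverage (v : ℝ) (f : ℝ → ℂ) (x : ℝ) : ℂ :=
  (v : ℂ)⁻¹ * ∫ t in (0 : ℝ)..v, ((v - t : ℝ) : ℂ) * f (x + t)

theorem rampAverage_const_mul (v : ℝ) (C : ℂ) (f : ℝ → ℂ) (x : ℝ) :
    rampAverage v (fun y => C * f y) x = C * rampAverage v f x := by
  simp only [rampAverage, mul_left_comm _ C, intervalIntegral.integral_const_mul]

theorem rampAverage_of_forall_eq (hv : 0 < v) (hx : 0 < x) {C : ℂ} (hf : ∀ y, 0 < y → f y = C) :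
    rampAverage v f x = v / 2 * C := by
  have hramp : ∫ t in (0 : ℝ)..v, ((v - t : ℝ) : ℂ) = v ^ 2 / 2 := by
    rw [intervalIntegral.integral_ofReal, intervalIntegral.integral_comp_sub_left (fun t => t),
      integral_id]
    push_cast
    ring
  have hcongr : ∫ t in (0 : ℝ)..v, ((v - t : ℝ) : ℂ) * f (x + t) =
      ∫ t in (0 : ℝ)..v, ((v - t : ℝ) : ℂ) * C :=
    intervalIntegral.integral_congr fun t ht => by
      rw [uIcc_of_le hv.le] at ht
      simp only [hf _ (add_pos_of_pos_of_nonneg hx ht.1)]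
  have hv' : (v : ℂ) ≠ 0 := Complex.ofReal_ne_zero.2 hv.ne'
  rw [rampAverage, hcongr, intervalIntegral.integral_mul_const, hramp]
  field_simp

theorem hasDerivAt_rampAverage (hv : 0 < v) (hf : ∀ y, 0 < y → HasDerivAt f (f' y) y)
    (hf' : ContinuousOn f' (Ioi 0)) (hx : 0 < x) :
    HasDerivAt (rampAverage v f) (rampAverage v f' x) x := by
  have hpos : ∀ {y t : ℝ}, 0 < y → t ∈ Icc 0 v → 0 < y + t := fun hy ht =>
    add_pos_of_pos_of_nonneg hy ht.1
  refine (hasDerivAt_intervalIntegral_of_continuousOn isOpen_Ioi hv.le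
    (f' := fun y t => ((v - t : ℝ) : ℂ) * f' (y + t)) ?_ ?_ ?_ (mem_Ioi.2 hx)).const_mul _
  · intro y hy t ht
    exact ContinuousWithinAt.mul (by fun_prop)
      (((hf _ (hpos hy ht)).comp_const_add y t).continuousAt.continuousWithinAt)
  · exact ContinuousOn.mul (by fun_prop) (hf'.comp (f := fun q : ℝ × ℝ => q.1 + q.2) (by fun_prop)
      fun q hq => hpos hq.1 hq.2)
  · exact fun y hy t ht => ((hf _ (hpos hy ht)).comp_add_const y t).const_mul _

theorem sub_eq_mul_add_rampAverage (hv : 0 < v) (hf : ∀ y, 0 < y → HasDerivAt f (f' y) y)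
    (hf' : ∀ y, 0 < y → HasDerivAt f' (f'' y) y) (hf'' : ContinuousOn f'' (Ioi 0)) (hx : 0 < x) :
    f (x + v) - f x = v * (f' x + rampAverage v f'' x) := by
  have hpos : ∀ {t}, t ∈ uIcc 0 v → 0 < x + t := fun ht => by
    rw [uIcc_of_le hv.le] at ht
    exact add_pos_of_pos_of_nonneg hx ht.1
  have hint : IntervalIntegrable (fun t => ((v - t : ℝ) : ℂ) * f'' (x + t)) volume 0 v :=
    (ContinuousOn.mul (by fun_prop)
      (hf''.comp (f := fun t => x + t) (by fun_prop) fun t ht => hpos ht)).intervalIntegrable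
  have hderiv : ∀ t ∈ uIcc 0 v, HasDerivAt (fun t : ℝ => f (x + t) + ((v - t : ℝ) : ℂ) * f' (x + t))
      (((v - t : ℝ) : ℂ) * f'' (x + t)) t := fun t ht => by
    have hramp : HasDerivAt (fun t : ℝ => ((v - t : ℝ) : ℂ)) ((-1 : ℝ) : ℂ) t :=
      ((hasDerivAt_id t).const_sub v).ofReal_comp
    refine (((hf _ (hpos ht)).comp_const_add x t).add
      (hramp.mul ((hf' _ (hpos ht)).comp_const_add x t))).congr_deriv ?_
    push_cast
    ring
  have hv' : (v : ℂ) ≠ 0 := Complex.ofReal_ne_zero.2 hv.ne'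
  rw [rampAverage, intervalIntegral.integral_eq_sub_of_hasDerivAt hderiv hint]
  simp only [sub_self, Complex.ofReal_zero, sub_zero, add_zero, zero_mul]
  field_simp
  ring

end RampAverage

/-- A family `F s x` (`s ∈ U`, `x > 0`) behaving like a multiple of the Barnes zeta function
`ζ(s, x)`: jointly continuous, holomorphic in `s`, and with `∂F/∂x (s, x) = (c - s) F (s + 1, x)`.
The offset `c` accounts for the poles that have been cancelled. -/
structure IsLadder (c : ℂ) (U : Set ℂ) (F : ℂ → ℝ → ℂ) : Prop where
  continuousOn : ContinuousOn (Function.uncurry F) (U ×ˢ Ioi 0)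
  differentiableOn : ∀ x, 0 < x → DifferentiableOn ℂ (fun s => F s x) U
  hasDerivAt : ∀ s ∈ U, s + 1 ∈ U → ∀ x, 0 < x → HasDerivAt (F s) ((c - s) * F (s + 1) x) x

namespace IsLadder

variable {c : ℂ} {U V : Set ℂ} {E F G : ℂ → ℝ → ℂ}

theorem continuousOn_left (h : IsLadder c U F) {x : ℝ} (hx : 0 < x) :
    ContinuousOn (fun s => F s x) U :=
  (h.differentiableOn x hx).continuousOn

theorem continuousOn_right (h : IsLadder c U F) {s : ℂ} (hs : s ∈ U) :
    ContinuousOn (F s) (Ioi 0) :=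
  h.continuousOn.comp (f := fun x => (s, x)) (by fun_prop) fun _ hx => ⟨hs, hx⟩

theorem mono (h : IsLadder c U F) (hV : V ⊆ U) : IsLadder c V F where
  continuousOn := h.continuousOn.mono (prod_mono hV subset_rfl)
  differentiableOn x hx := (h.differentiableOn x hx).mono hV
  hasDerivAt s hs hs1 := h.hasDerivAt s (hV hs) (hV hs1)

theorem congr (h : IsLadder c U F) (hG : ∀ s ∈ U, EqOn (G s) (F s) (Ioi 0)) : IsLadder c U G where
  continuousOn := h.continuousOn.congr fun p hp => hG p.1 hp.1 hp.2
  differentiableOn x hx := (h.differentiableOn x hx).congr fun s hs => hG s hs hx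
  hasDerivAt s hs hs1 x hx := by
    rw [hG (s + 1) hs1 hx]
    exact (h.hasDerivAt s hs hs1 x hx).congr_of_eventuallyEq
      ((hG s hs).eventuallyEq_of_mem (Ioi_mem_nhds hx))

theorem add (hF : IsLadder c U F) (hG : IsLadder c U G) :
    IsLadder c U (fun s x => F s x + G s x) where
  continuousOn := hF.continuousOn.add hG.continuousOn
  differentiableOn x hx := (hF.differentiableOn x hx).add (hG.differentiableOn x hx)
  hasDerivAt s hs hs1 x hx := by
    rw [mul_add]
    exact (hF.hasDerivAt s hs hs1 x hx).add (hG.hasDerivAt s hs hs1 x hx)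

theorem mul_left (h : IsLadder c U F) {c' : ℂ} {p : ℂ → ℂ} (hp : DifferentiableOn ℂ p U)
    (hpc : ∀ s ∈ U, s + 1 ∈ U → p s * (c - s) = (c' - s) * p (s + 1)) :
    IsLadder c' U (fun s x => p s * F s x) where
  continuousOn := (hp.continuousOn.comp continuousOn_fst fun _ hq => hq.1).mul h.continuousOn
  differentiableOn x hx := hp.mul (h.differentiableOn x hx)
  hasDerivAt s hs hs1 x hx := by
    rw [← mul_assoc, ← hpc s hs hs1, mul_assoc]
    exact (h.hasDerivAt s hs hs1 x hx).const_mul _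

theorem comp_add_const (h : IsLadder c U F) (a : ℂ) :
    IsLadder (c - a) ((· + a) ⁻¹' U) (fun s x => F (s + a) x) where
  continuousOn := h.continuousOn.comp (f := fun q : ℂ × ℝ => (q.1 + a, q.2)) (by fun_prop)
    fun _ hq => hq
  differentiableOn x hx := (h.differentiableOn x hx).comp (f := (· + a)) (by fun_prop)
    fun _ hs => hs
  hasDerivAt s hs hs1 x hx := by
    rw [mem_preimage, add_right_comm] at hs1
    rw [sub_sub, add_comm a, add_right_comm]
    exact h.hasDerivAt (s + a) hs hs1 x hx

theorem comp_rampAverage (h : IsLadder c U F) (hU : IsOpen U) {v : ℝ} (hv : 0 < v) :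
    IsLadder c U (fun s => rampAverage v (F s)) where
  continuousOn := by
    refine continuousOn_const.mul (continuousOn_intervalIntegral_of_continuousOn hv.le
      (f := fun (p : ℂ × ℝ) t => ((v - t : ℝ) : ℂ) * F p.1 (p.2 + t)) ?_)
    exact ContinuousOn.mul (by fun_prop) (h.continuousOn.comp
      (f := fun q : (ℂ × ℝ) × ℝ => (q.1.1, q.1.2 + q.2)) (by fun_prop)
      fun q hq => ⟨hq.1.1, add_pos_of_pos_of_nonneg hq.1.2 hq.2.1⟩)
  differentiableOn x hx := by
    have hpos : ∀ t ∈ Icc 0 v, 0 < x + t := fun t ht => add_pos_of_pos_of_nonneg hx ht.1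
    refine (differentiableOn_intervalIntegral_of_continuousOn hU hv.le ?_
      fun t ht => (h.differentiableOn _ (hpos t ht)).const_mul _).const_mul _
    exact ContinuousOn.mul (by fun_prop) (h.continuousOn.comp
      (f := fun q : ℂ × ℝ => (q.1, x + q.2)) (by fun_prop) fun q hq => ⟨hq.1, hpos q.2 hq.2⟩)
  hasDerivAt s hs hs1 x hx := by
    rw [← rampAverage_const_mul]
    exact hasDerivAt_rampAverage hv (h.hasDerivAt s hs hs1)
      (continuousOn_const.mul (h.continuousOn_right hs1)) hx

theorem rampAverage_step (h : IsLadder c U F) (hU : IsOpen U) {v : ℝ} (hv : 0 < v) :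
    IsLadder c ((· + 1) ⁻¹' U) (fun s x => (s - c) * rampAverage v (F (s + 1)) x) :=
  ((h.comp_rampAverage hU hv).comp_add_const 1).mul_left (by fun_prop) fun s _ _ => by ring

theorem iUnion {ι : Type*} {U : ι → Set ℂ} (hU : ∀ i, IsOpen (U i)) (hdir : Directed (· ⊆ ·) U)
    (h : ∀ i, IsLadder c (U i) F) : IsLadder c (⋃ i, U i) F where
  continuousOn := by
    rintro ⟨s, x⟩ ⟨hs, hx⟩
    obtain ⟨i, hi⟩ := mem_iUnion.1 hs
    exact ((h i).continuousOn.continuousAt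
      (((hU i).prod isOpen_Ioi).mem_nhds ⟨hi, hx⟩)).continuousWithinAt
  differentiableOn x hx := by
    intro s hs
    obtain ⟨i, hi⟩ := mem_iUnion.1 hs
    exact (((h i).differentiableOn x hx).differentiableAt
      ((hU i).mem_nhds hi)).differentiableWithinAt
  hasDerivAt s hs hs1 := by
    obtain ⟨i, hi⟩ := mem_iUnion.1 hs
    obtain ⟨j, hj⟩ := mem_iUnion.1 hs1
    obtain ⟨k, hik, hjk⟩ := hdir i j
    exact (h k).hasDerivAt s (hik hi) (hjk hj)

theorem sub_eq (h : IsLadder c U F) {s : ℂ} (hs0 : s - 1 ∈ U) (hs : s ∈ U) (hs1 : s + 1 ∈ U)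
    {v x : ℝ} (hv : 0 < v) (hx : 0 < x) :
    F (s - 1) (x + v) - F (s - 1) x =
      (c + 1 - s) * (v * (F s x + (c - s) * rampAverage v (F (s + 1)) x)) := by
  have hf : ∀ y, 0 < y → HasDerivAt (F (s - 1)) ((c + 1 - s) * F s y) y := fun y hy => by
    have := h.hasDerivAt (s - 1) hs0 (by rwa [sub_add_cancel]) y hy
    rwa [sub_add_cancel, ← sub_add, sub_add_eq_add_sub] at this
  have hf' : ∀ y, 0 < y → HasDerivAt (fun y => (c + 1 - s) * F s y)
      ((c + 1 - s) * ((c - s) * F (s + 1) y)) y := fun y hy =>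
    (h.hasDerivAt s hs hs1 y hy).const_mul _
  rw [sub_eq_mul_add_rampAverage hv hf hf' (continuousOn_const.mul
    (continuousOn_const.mul (h.continuousOn_right hs1))) hx, rampAverage_const_mul,
    rampAverage_const_mul]
  ring

/-- The solution `G` of `G s x = E s x + (s - c) * rampAverage v (G (s + 1)) x` that agrees with `F`
on the half-plane `σ < re s`. -/
noncomputable def leftExtension (c : ℂ) (σ v : ℝ) (E F : ℂ → ℝ → ℂ) (s : ℂ) : ℝ → ℂ :=
  if σ < s.re then F s
  else fun x => E s x + (s - c) * rampAverage v (leftExtension c σ v E F (s + 1)) x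
termination_by ⌊σ - s.re + 1⌋₊
decreasing_by
  have hs : 0 ≤ σ - s.re := sub_nonneg.2 (not_lt.1 ‹_›)
  rw [Complex.add_re, Complex.one_re, ← sub_sub, sub_add_cancel, Nat.floor_add_one hs]
  exact Nat.lt_succ_self _

theorem leftExtension_of_lt {σ v : ℝ} {s : ℂ} (hs : σ < s.re) :
    leftExtension c σ v E F s = F s := by
  rw [leftExtension, if_pos hs]

theorem leftExtension_eq {σ v : ℝ}
    (hrec : ∀ s : ℂ, σ < s.re → ∀ x, 0 < x →
      F s x = E s x + (s - c) * rampAverage v (F (s + 1)) x) (s : ℂ) {x : ℝ} (hx : 0 < x) :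
    leftExtension c σ v E F s x =
      E s x + (s - c) * rampAverage v (leftExtension c σ v E F (s + 1)) x := by
  by_cases hs : σ < s.re
  · have hs1 : σ < (s + 1).re := hs.trans (by simp)
    rw [leftExtension_of_lt hs, leftExtension_of_lt hs1, hrec s hs x hx]
  · rw [leftExtension, if_neg hs]

theorem exists_extension (hE : IsLadder c univ E) {σ : ℝ} (hF : IsLadder c {s | σ < s.re} F)
    {v : ℝ} (hv : 0 < v)
    (hrec : ∀ s : ℂ, σ < s.re → ∀ x, 0 < x →
      F s x = E s x + (s - c) * rampAverage v (F (s + 1)) x) :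
    ∃ G : ℂ → ℝ → ℂ, IsLadder c univ G ∧ (∀ s : ℂ, σ < s.re → G s = F s) ∧
      ∀ s x, 0 < x → G s x = E s x + (s - c) * rampAverage v (G (s + 1)) x := by
  set G := leftExtension c σ v E F
  have hGrec : ∀ s x, 0 < x → G s x = E s x + (s - c) * rampAverage v (G (s + 1)) x :=
    fun s x hx => leftExtension_eq hrec s hx
  have hladder : ∀ n : ℕ, IsLadder c {s | σ - n < s.re} G := fun n => by
    induction n with
    | zero =>
      simp only [Nat.cast_zero, sub_zero]
      exact hF.congr fun s hs x _ => congrFun (leftExtension_of_lt hs) x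
    | succ n ih =>
      have hstep := (ih.rampAverage_step (isOpen_re_gt _) hv).mono
        (V := {s | σ - (n + 1 : ℕ) < s.re}) fun s hs => by
          simp only [Nat.cast_add, Nat.cast_one, mem_ofPred_eq, mem_preimage, Complex.add_re,
            Complex.one_re] at hs ⊢
          linarith
      exact ((hE.mono (subset_univ _)).add hstep).congr fun s _ x hx => hGrec s x hx
  have hcover : (⋃ n : ℕ, {s : ℂ | σ - n < s.re}) = univ := by
    refine iUnion_eq_univ_iff.2 fun s => ?_
    obtain ⟨n, hn⟩ := exists_nat_gt (σ - s.re)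
    exact ⟨n, sub_lt_comm.1 hn⟩
  refine ⟨G, hcover ▸ iUnion (fun n => isOpen_re_gt _) ?_ hladder,
    fun s hs => leftExtension_of_lt hs, hGrec⟩
  exact Monotone.directed_le fun m n hmn s (hs : σ - m < s.re) =>
    (sub_le_sub_left (Nat.cast_le.2 hmn) σ).trans_lt hs

end IsLadder

section ShiftedSeries

theorem hasDerivAt_ofReal_cpow (r : ℂ) {x : ℝ} (hx : 0 < x) :
    HasDerivAt (fun y : ℝ => (y : ℂ) ^ r) (r * (x : ℂ) ^ (r - 1)) x := by
  simpa using ((hasDerivAt_id (x : ℂ)).cpow_const (c := r) (Or.inl (by simpa using hx))).comp_ofReal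

theorem continuousOn_ofReal_cpow_neg :
    ContinuousOn (fun p : ℂ × ℝ => (p.2 : ℂ) ^ (-p.1)) (univ ×ˢ Ioi 0) := by
  refine ContinuousOn.cpow (by fun_prop) (by fun_prop) fun p hp => Or.inl ?_
  simpa using hp.2

theorem norm_ofReal_add_cpow_neg_le {δ σ R x l : ℝ} {s : ℂ} (hδ : 0 < δ) (hδ1 : δ ≤ 1) (hx : δ ≤ x)
    (hl : 0 ≤ l) (hσ : 0 ≤ σ) (hs : σ ≤ s.re) (hR : s.re ≤ R) :
    ‖((x + l : ℝ) : ℂ) ^ (-s)‖ ≤ δ ^ (-R) * (1 + l) ^ (-σ) := by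
  have hxl : 0 < x + l := by linarith
  rw [Complex.norm_cpow_eq_rpow_re_of_pos hxl, Complex.neg_re]
  calc (x + l) ^ (-s.re) ≤ (δ * (1 + l)) ^ (-s.re) :=
        Real.rpow_le_rpow_of_nonpos (by positivity) (by nlinarith) (by linarith)
    _ = δ ^ (-s.re) * (1 + l) ^ (-s.re) := Real.mul_rpow hδ.le (by linarith)
    _ ≤ δ ^ (-R) * (1 + l) ^ (-σ) := by
        gcongr ?_ * ?_
        · exact Real.rpow_le_rpow_of_exponent_ge hδ hδ1 (by linarith)
        · exact Real.rpow_le_rpow_of_exponent_le (by linarith) (by linarith)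

/-- The generalized Hurwitz series `∑ᵢ (x + lᵢ)^{-s}`. -/
noncomputable def shiftedSeries {ι : Type*} (l : ι → ℝ) (s : ℂ) (x : ℝ) : ℂ :=
  ∑' i, ((x + l i : ℝ) : ℂ) ^ (-s)

/-- The family of shifts `lᵢ + n w`, `n ≥ 0`; iterating it produces the lattices of the Barnes zeta
functions. -/
def addMultiples {ι : Type*} (l : ι → ℝ) (w : ℝ) (p : ι × ℕ) : ℝ :=
  l p.1 + p.2 * w

/-- The shifts `l` are nonnegative and the abscissa of convergence of `shiftedSeries l` is at most
`c`, where `0 ≤ c`. -/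
structure HasAbscissaLE {ι : Type*} (l : ι → ℝ) (c : ℝ) : Prop where
  abscissa_nonneg : 0 ≤ c
  nonneg : ∀ i, 0 ≤ l i
  summable : ∀ σ, c < σ → Summable fun i => (1 + l i) ^ (-σ)

namespace HasAbscissaLE

variable {ι κ : Type*} {l : ι → ℝ} {l' : κ → ℝ} {c c' : ℝ}

theorem zero [Finite ι] : HasAbscissaLE (fun _ : ι => 0) 0 where
  abscissa_nonneg := le_rfl
  nonneg _ := le_rfl
  summable _ _ := .of_finite

theorem nat_mul {w : ℝ} (hw : 0 < w) : HasAbscissaLE (fun n : ℕ => n * w) 1 where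
  abscissa_nonneg := zero_le_one
  nonneg n := by positivity
  summable σ hσ := by
    have hmin : 0 < min 1 w := lt_min one_pos hw
    have hzeta : Summable fun n : ℕ => ((n : ℝ) + 1) ^ (-σ) := by
      simpa using (summable_nat_add_iff 1).2 (Real.summable_nat_rpow.2 (by linarith : -σ < -1))
    refine .of_nonneg_of_le (fun n => by positivity) (fun n => ?_)
      (hzeta.mul_left (min 1 w ^ (-σ)))
    rw [← Real.mul_rpow hmin.le (by positivity)]
    refine Real.rpow_le_rpow_of_nonpos (by positivity) ?_ (by linarith)
    nlinarith [min_le_left 1 w, min_le_right 1 w, n.cast_nonneg (α := ℝ)]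

theorem add (h : HasAbscissaLE l c) (h' : HasAbscissaLE l' c') :
    HasAbscissaLE (fun p : ι × κ => l p.1 + l' p.2) (c + c') where
  abscissa_nonneg := add_nonneg h.abscissa_nonneg h'.abscissa_nonneg
  nonneg p := add_nonneg (h.nonneg p.1) (h'.nonneg p.2)
  summable σ hσ := by
    obtain ⟨τ, hτ, hτσ⟩ := exists_between (lt_sub_iff_add_lt.2 hσ)
    have hτ' : c' < σ - τ := lt_sub_comm.1 hτσ
    have hpos : ∀ i, 0 < 1 + l i := fun i => add_pos_of_pos_of_nonneg one_pos (h.nonneg i)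
    have hpos' : ∀ j, 0 < 1 + l' j := fun j => add_pos_of_pos_of_nonneg one_pos (h'.nonneg j)
    have hpos_add : ∀ p : ι × κ, 0 < 1 + (l p.1 + l' p.2) := fun p => by
      linarith [hpos p.1, h'.nonneg p.2]
    refine .of_nonneg_of_le (fun p => (Real.rpow_pos_of_pos (hpos_add p) _).le) (fun p => ?_)
      ((h.summable τ hτ).mul_of_nonneg (h'.summable (σ - τ) hτ')
        (fun i => (Real.rpow_pos_of_pos (hpos i) _).le)
        fun j => (Real.rpow_pos_of_pos (hpos' j) _).le)
    calc (1 + (l p.1 + l' p.2)) ^ (-σ)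
        = (1 + (l p.1 + l' p.2)) ^ (-τ) * (1 + (l p.1 + l' p.2)) ^ (-(σ - τ)) := by
          rw [← Real.rpow_add (hpos_add p)]
          ring_nf
      _ ≤ (1 + l p.1) ^ (-τ) * (1 + l' p.2) ^ (-(σ - τ)) := by
          refine mul_le_mul
            (Real.rpow_le_rpow_of_nonpos (hpos _) (by linarith [h'.nonneg p.2]) ?_)
            (Real.rpow_le_rpow_of_nonpos (hpos' _) (by linarith [h.nonneg p.1]) ?_)
            (Real.rpow_pos_of_pos (hpos_add p) _).le (Real.rpow_pos_of_pos (hpos _) _).le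
          · linarith [h.abscissa_nonneg]
          · linarith [h'.abscissa_nonneg]

theorem add_multiples (h : HasAbscissaLE l c) {w : ℝ} (hw : 0 < w) :
    HasAbscissaLE (addMultiples l w) (c + 1) :=
  h.add (nat_mul hw)

theorem exists_majorant (h : HasAbscissaLE l c) {δ : ℝ} (hδ : 0 < δ) {s₀ : ℂ} (hs₀ : c < s₀.re) :
    ∃ (V : Set ℂ) (u : ι → ℝ), IsOpen V ∧ s₀ ∈ V ∧ Summable u ∧
      ∀ i, ∀ s ∈ V, ∀ x, δ ≤ x → ‖((x + l i : ℝ) : ℂ) ^ (-s)‖ ≤ u i := by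
  obtain ⟨σ, hcσ, hσ⟩ := exists_between hs₀
  refine ⟨{s : ℂ | σ < s.re} ∩ {s : ℂ | s.re < s₀.re + 1},
    fun i => (min δ 1) ^ (-(s₀.re + 1)) * (1 + l i) ^ (-σ),
    (isOpen_re_gt σ).inter (isOpen_lt Complex.continuous_re continuous_const),
    ⟨hσ, lt_add_one s₀.re⟩, (h.summable σ hcσ).mul_left _, fun i s hs x hx => ?_⟩
  exact norm_ofReal_add_cpow_neg_le (lt_min hδ one_pos) (min_le_right _ _)
    ((min_le_left _ _).trans hx) (h.nonneg i) (h.abscissa_nonneg.trans hcσ.le) (le_of_lt hs.1)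
    (le_of_lt hs.2)

theorem summable_cpow (h : HasAbscissaLE l c) {s : ℂ} (hs : c < s.re) {x : ℝ} (hx : 0 < x) :
    Summable fun i => ((x + l i : ℝ) : ℂ) ^ (-s) := by
  obtain ⟨V, u, -, hsV, hu, hle⟩ := h.exists_majorant hx hs
  exact .of_norm_bounded hu fun i => hle i s hsV x le_rfl

theorem add_pos (h : HasAbscissaLE l c) (i : ι) {x : ℝ} (hx : 0 < x) : 0 < x + l i :=
  add_pos_of_pos_of_nonneg hx (h.nonneg i)

theorem continuousOn_shiftedSeries (h : HasAbscissaLE l c) :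
    ContinuousOn (Function.uncurry (shiftedSeries l)) ({s : ℂ | c < s.re} ×ˢ Ioi 0) := by
  rintro ⟨s₀, x₀⟩ ⟨hs₀, hx₀⟩
  rw [mem_Ioi] at hx₀
  obtain ⟨V, u, hV, hsV, hu, hle⟩ := h.exists_majorant (half_pos hx₀) hs₀
  have hon : ContinuousOn (Function.uncurry (shiftedSeries l)) (V ×ˢ Ioi (x₀ / 2)) := by
    refine continuousOn_tsum (fun i => ?_) hu fun i p hp => hle i p.1 hp.1 p.2 (le_of_lt hp.2)
    exact continuousOn_ofReal_cpow_neg.comp (f := fun p : ℂ × ℝ => (p.1, p.2 + l i))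
      (by fun_prop) fun p hp => ⟨mem_univ _, h.add_pos i ((half_pos hx₀).trans hp.2)⟩
  exact (hon.continuousAt ((hV.prod isOpen_Ioi).mem_nhds
    ⟨hsV, half_lt_self hx₀⟩)).continuousWithinAt

theorem differentiableOn_shiftedSeries (h : HasAbscissaLE l c) {x : ℝ} (hx : 0 < x) :
    DifferentiableOn ℂ (fun s => shiftedSeries l s x) {s : ℂ | c < s.re} := by
  intro s₀ hs₀
  obtain ⟨V, u, hV, hsV, hu, hle⟩ := h.exists_majorant hx hs₀
  refine ((Complex.differentiableOn_tsum_of_summable_norm hu (fun i => ?_) hV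
    fun i s hs => hle i s hs x le_rfl).differentiableAt (hV.mem_nhds hsV)).differentiableWithinAt
  exact DifferentiableOn.const_cpow (by fun_prop)
    (Or.inl (Complex.ofReal_ne_zero.2 (h.add_pos i hx).ne'))

theorem hasDerivAt_shiftedSeries (h : HasAbscissaLE l c) {s : ℂ} (hs : c < s.re) {x : ℝ}
    (hx : 0 < x) : HasDerivAt (shiftedSeries l s) (-s * shiftedSeries l (s + 1) x) x := by
  have hs1 : c < (s + 1).re := hs.trans (by simp)
  obtain ⟨V, u, -, hsV, hu, hle⟩ := h.exists_majorant (half_pos hx) hs1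
  rw [shiftedSeries, ← tsum_mul_left]
  refine hasDerivAt_tsum_of_isPreconnected (t := Ioi (x / 2)) (y₀ := x)
    (g := fun i (y : ℝ) => ((y + l i : ℝ) : ℂ) ^ (-s))
    (g' := fun i y => -s * ((y + l i : ℝ) : ℂ) ^ (-(s + 1)))
    (hu.mul_left ‖-s‖) isOpen_Ioi isPreconnected_Ioi (fun i y hy => ?_) (fun i y hy => ?_)
    (half_lt_self hx) (h.summable_cpow hs hx) (half_lt_self hx)
  · rw [neg_add']
    exact (hasDerivAt_ofReal_cpow (-s) (h.add_pos i ((half_pos hx).trans hy))).comp_add_const y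
      (l i)
  · rw [norm_mul]
    exact mul_le_mul_of_nonneg_left (hle i _ hsV y (le_of_lt hy)) (norm_nonneg _)

theorem isLadder_shiftedSeries (h : HasAbscissaLE l c) :
    IsLadder 0 {s | c < s.re} (shiftedSeries l) where
  continuousOn := h.continuousOn_shiftedSeries
  differentiableOn _ hx := h.differentiableOn_shiftedSeries hx
  hasDerivAt s hs _ x hx := by
    rw [zero_sub]
    exact h.hasDerivAt_shiftedSeries hs hx

theorem shiftedSeries_addMultiples_sub (h : HasAbscissaLE l c) {w : ℝ} (hw : 0 < w) {s : ℂ}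
    (hs : c + 1 < s.re) {x : ℝ} (hx : 0 < x) :
    shiftedSeries (addMultiples l w) s x -
      shiftedSeries (addMultiples l w) s (x + w) = shiftedSeries l s x := by
  have hsummable : ∀ y, 0 < y → Summable fun p : ι × ℕ =>
      ((y + (l p.1 + p.2 * w) : ℝ) : ℂ) ^ (-s) :=
    fun y hy => (h.add_multiples hw).summable_cpow hs hy
  have hxw : 0 < x + w := by linarith
  have hfiber : ∀ i, ∑' n : ℕ, ((x + (l i + n * w) : ℝ) : ℂ) ^ (-s) =
      ((x + l i : ℝ) : ℂ) ^ (-s) + ∑' n : ℕ, ((x + w + (l i + n * w) : ℝ) : ℂ) ^ (-s) := fun i => by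
    rw [((hsummable x hx).prod_factor i).tsum_eq_zero_add]
    congr 1
    · simp only [Nat.cast_zero, zero_mul, add_zero]
    · refine tsum_congr fun n => ?_
      push_cast
      ring_nf
  simp only [shiftedSeries, addMultiples]
  rw [(hsummable x hx).tsum_prod, (hsummable _ hxw).tsum_prod, tsum_congr hfiber,
    (h.summable_cpow (by linarith) hx).tsum_add (hsummable _ hxw).prod, add_sub_cancel_right]

end HasAbscissaLE

end ShiftedSeries

section Regularization

/-- The polynomial `(s - 1) ⋯ (s - d)`, which cancels the poles of the Barnes zeta function of order
`d`. -/
noncomputable def poleFactor (d : ℕ) (s : ℂ) : ℂ :=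
  ∏ j ∈ Finset.range d, (s - (j + 1))

theorem differentiable_poleFactor (d : ℕ) : Differentiable ℂ (poleFactor d) := by
  unfold poleFactor
  fun_prop

theorem poleFactor_succ (d : ℕ) (s : ℂ) : poleFactor (d + 1) s = poleFactor d s * (s - (d + 1)) :=
  Finset.prod_range_succ _ _

theorem poleFactor_succ_add_one (d : ℕ) (s : ℂ) :
    poleFactor (d + 1) (s + 1) = s * poleFactor d s := by
  simp [poleFactor, Finset.prod_range_succ', mul_comm]

theorem mul_poleFactor (d : ℕ) (s : ℂ) :
    s * poleFactor d s = (s - d) * poleFactor d (s + 1) := by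
  rw [← poleFactor_succ_add_one, poleFactor_succ]
  ring

theorem poleFactor_two (s : ℂ) : poleFactor 2 s = (s - 1) * (s - 2) := by
  simp only [poleFactor, Finset.prod_range_succ, Finset.prod_range_zero]
  push_cast
  ring

variable {ι : Type*} {l : ι → ℝ} {d : ℕ} {H : ℂ → ℝ → ℂ}

/-- The series `(s - 1) ⋯ (s - d) ∑ᵢ (x + lᵢ)^{-s}`. -/
noncomputable def regularizedSeries (l : ι → ℝ) (d : ℕ) (s : ℂ) (x : ℝ) : ℂ :=
  poleFactor d s * shiftedSeries l s x

theorem HasAbscissaLE.isLadder_regularizedSeries (h : HasAbscissaLE l d) :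
    IsLadder d {s | d < s.re} (regularizedSeries l d) :=
  h.isLadder_shiftedSeries.mul_left (differentiable_poleFactor _).differentiableOn
    fun s _ _ => by linear_combination -mul_poleFactor d s

/-- The shifts `l` have abscissa of convergence at most `d`, and `H` is the entire continuation of
`regularizedSeries l d`. -/
structure IsRegularization (l : ι → ℝ) (d : ℕ) (H : ℂ → ℝ → ℂ) : Prop where
  hasAbscissaLE : HasAbscissaLE l d
  isLadder : IsLadder d univ H
  eq_regularizedSeries : ∀ s : ℂ, d < s.re → ∀ x, 0 < x → H s x = regularizedSeries l d s x

theorem isRegularization_cpow_neg :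
    IsRegularization (fun _ : Unit => 0) 0 (fun s x => (x : ℂ) ^ (-s)) where
  hasAbscissaLE := by simpa only [Nat.cast_zero] using HasAbscissaLE.zero
  isLadder :=
    { continuousOn := continuousOn_ofReal_cpow_neg
      differentiableOn := fun x hx => DifferentiableOn.const_cpow (by fun_prop)
        (Or.inl (Complex.ofReal_ne_zero.2 hx.ne'))
      hasDerivAt := fun s _ _ x hx => by
        rw [Nat.cast_zero, zero_sub, neg_add']
        exact hasDerivAt_ofReal_cpow (-s) hx }
  eq_regularizedSeries s _ x _ := by simp [regularizedSeries, poleFactor, shiftedSeries]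

namespace IsRegularization

theorem hasAbscissaLE_addMultiples (h : IsRegularization l d H) {w : ℝ} (hw : 0 < w) :
    HasAbscissaLE (addMultiples l w) (d + 1 : ℕ) := by
  rw [Nat.cast_succ]
  exact h.hasAbscissaLE.add_multiples hw

-- Expand the series at `s - 1` from `x` to `x + w` by Taylor's formula. The increment telescopes
-- to a multiple of `H (s - 1) x`, and the factor `d + 2 - s` common to both sides cancels.
theorem regularizedSeries_eq_of_add_two_lt (h : IsRegularization l d H) {w : ℝ} (hw : 0 < w)
    {s : ℂ} (hs : (d : ℝ) + 2 < s.re) {x : ℝ} (hx : 0 < x) :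
    regularizedSeries (addMultiples l w) (d + 1) s x = (w : ℂ)⁻¹ * H (s - 1) x +
      (s - (d + 1 : ℕ)) *
        rampAverage w (regularizedSeries (addMultiples l w) (d + 1) (s + 1)) x := by
  have hs1 : (s - 1).re = s.re - 1 := by simp
  have hs2 : (s + 1).re = s.re + 1 := by simp
  have hmem : ∀ z : ℂ, s.re - 1 ≤ z.re → z ∈ {z : ℂ | (d + 1 : ℕ) < z.re} := fun z hz => by
    rw [mem_ofPred_eq, Nat.cast_succ]
    linarith
  have htaylor := (h.hasAbscissaLE_addMultiples hw).isLadder_regularizedSeries.sub_eq (s := s)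
    (hmem _ (by linarith)) (hmem _ (by linarith)) (hmem _ (by linarith)) hw hx
  have htelescope := h.hasAbscissaLE.shiftedSeries_addMultiples_sub hw (s := s - 1)
    (by linarith) hx
  have hincrement : regularizedSeries (addMultiples l w) (d + 1) (s - 1) (x + w) -
      regularizedSeries (addMultiples l w) (d + 1) (s - 1) x =
      ((d + 1 : ℕ) + 1 - s) * H (s - 1) x := by
    rw [h.eq_regularizedSeries (s - 1) (by linarith) x hx]
    simp only [regularizedSeries, poleFactor_succ]
    push_cast
    linear_combination -poleFactor d (s - 1) * (s - 1 - (d + 1)) * htelescope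
  have hne : ((d + 1 : ℕ) : ℂ) + 1 - s ≠ 0 := fun h0 => by
    have hre := congrArg Complex.re (sub_eq_zero.1 h0)
    rw [Complex.add_re, Complex.natCast_re, Complex.one_re, Nat.cast_succ] at hre
    linarith
  have hcancel := mul_left_cancel₀ hne (hincrement.symm.trans htaylor)
  rw [hcancel, inv_mul_cancel_left₀ (Complex.ofReal_ne_zero.2 hw.ne')]
  ring

theorem isLadder_inv_mul_sub_one (h : IsRegularization l d H) (w : ℝ) :
    IsLadder (d + 1 : ℕ) univ (fun s x => (w : ℂ)⁻¹ * H (s - 1) x) := by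
  have := (h.isLadder.comp_add_const (-1)).mul_left (c' := (d + 1 : ℕ)) (p := fun _ => (w : ℂ)⁻¹)
    (by fun_prop) fun s _ _ => by push_cast; ring
  simpa only [preimage_univ, ← sub_eq_add_neg] using this

theorem regularizedSeries_eq (h : IsRegularization l d H) {w : ℝ} (hw : 0 < w)
    {s : ℂ} (hs : (d + 1 : ℕ) < s.re) {x : ℝ} (hx : 0 < x) :
    regularizedSeries (addMultiples l w) (d + 1) s x = (w : ℂ)⁻¹ * H (s - 1) x +
      (s - (d + 1 : ℕ)) *
        rampAverage w (regularizedSeries (addMultiples l w) (d + 1) (s + 1)) x := by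
  have hF := (h.hasAbscissaLE_addMultiples hw).isLadder_regularizedSeries
  have hsub : {s : ℂ | (d + 1 : ℕ) < s.re} ⊆ (· + 1) ⁻¹' {s : ℂ | (d + 1 : ℕ) < s.re} :=
    fun z hz => by
      simp only [mem_preimage, mem_ofPred_eq, Complex.add_re, Complex.one_re] at hz ⊢
      linarith
  have hrhs := ((h.isLadder_inv_mul_sub_one w).mono (subset_univ _)).add
    ((hF.rampAverage_step (isOpen_re_gt _) hw).mono hsub)
  refine eqOn_of_eqOn_re_gt (τ := d + 2) (isOpen_re_gt _) (convex_halfSpace_re_gt _).isPreconnected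
    ⟨(d + 3 : ℕ), ?_, ?_⟩ (hF.differentiableOn x hx) (hrhs.differentiableOn x hx)
    (fun s hs => h.regularizedSeries_eq_of_add_two_lt hw hs hx) hs
  · rw [mem_ofPred_eq, Complex.natCast_re]
    gcongr
    norm_num
  · rw [Complex.natCast_re]
    push_cast
    linarith

theorem exists_addMultiples (h : IsRegularization l d H) {w : ℝ} (hw : 0 < w) :
    ∃ G, IsRegularization (addMultiples l w) (d + 1) G ∧
      ∀ s x, 0 < x → G s x = (w : ℂ)⁻¹ * H (s - 1) x +
        (s - (d + 1 : ℕ)) * rampAverage w (G (s + 1)) x := by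
  have habs := h.hasAbscissaLE_addMultiples hw
  obtain ⟨G, hG, hGF, hGrec⟩ := (h.isLadder_inv_mul_sub_one w).exists_extension
    habs.isLadder_regularizedSeries hw fun s hs x hx => h.regularizedSeries_eq hw hs hx
  exact ⟨G, ⟨habs, hG, fun s hs x _ => congrFun (hGF s hs) x⟩, hGrec⟩

end IsRegularization

theorem exists_isRegularization_two {v w : ℝ} (hv : 0 < v) (hw : 0 < w) :
    ∃ G, IsRegularization (addMultiples (addMultiples (fun _ : Unit => 0) v) w) 2 G ∧
      ∀ x : ℝ, 0 < x → G 1 x = (2 * x - v - w) / (2 * v * w) := by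
  have hv' : (v : ℂ) ≠ 0 := Complex.ofReal_ne_zero.2 hv.ne'
  have hw' : (w : ℂ) ≠ 0 := Complex.ofReal_ne_zero.2 hw.ne'
  obtain ⟨H, hH, hHrec⟩ := isRegularization_cpow_neg.exists_addMultiples hv
  obtain ⟨G, hG, hGrec⟩ := hH.exists_addMultiples hw
  have hH1 : ∀ x : ℝ, 0 < x → H 1 x = (v : ℂ)⁻¹ := fun x hx => by
    simp [hHrec 1 x hx]
  have hH0 : ∀ x : ℝ, 0 < x → H 0 x = (v : ℂ)⁻¹ * x - 1 / 2 := fun x hx => by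
    rw [hHrec 0 x hx, zero_add (1 : ℂ), rampAverage_of_forall_eq hv hx hH1, zero_sub, neg_neg,
      Complex.cpow_one]
    push_cast
    field_simp
    ring
  have hG2 : ∀ x : ℝ, 0 < x → G 2 x = (w : ℂ)⁻¹ * (v : ℂ)⁻¹ := fun x hx => by
    rw [hGrec 2 x hx, show (2 : ℂ) - 1 = 1 by norm_num, hH1 x hx]
    simp
  refine ⟨G, hG, fun x hx => ?_⟩
  rw [hGrec 1 x hx, one_add_one_eq_two, rampAverage_of_forall_eq hw hx hG2, sub_self, hH0 x hx]
  push_cast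
  field_simp
  ring

end Regularization

section LaurentCoeff

/-- The coefficient of `(s - c) ^ k` in the Laurent expansion of `f` at `c`, as a contour integral
over the circle of radius `R`. -/
noncomputable def laurentCoeff (f : ℂ → ℂ) (c : ℂ) (R : ℝ) (k : ℤ) : ℂ :=
  (2 * Real.pi * Complex.I)⁻¹ * ∮ s in C(c, R), f s / (s - c) ^ (k + 1)

variable {f g : ℂ → ℂ} {c : ℂ} {R : ℝ}

theorem sub_ne_zero_of_mem_sphere (hR : 0 < R) {s : ℂ} (hs : s ∈ sphere c R) : s - c ≠ 0 :=
  sub_ne_zero.2 (ne_of_mem_sphere hs hR.ne')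

theorem laurentCoeff_of_eq_div (hR : 0 < R) (hf : ∀ s ∈ sphere c R, f s = g s / (s - c)) (k : ℤ) :
    laurentCoeff f c R k = laurentCoeff g c R (k + 1) := by
  refine congrArg _ (circleIntegral.integral_congr hR.le fun s hs => ?_)
  simp only [hf s hs]
  rw [div_div, zpow_add_one₀ (sub_ne_zero_of_mem_sphere hR hs) (k + 1), mul_comm]

theorem laurentCoeff_natCast (hR : 0 < R) (hf : DifferentiableOn ℂ f (closedBall c R)) (n : ℕ) :
    laurentCoeff f c R n = (n.factorial : ℂ)⁻¹ * iteratedDeriv n f c := by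
  have hcauchy := hf.circleIntegral_one_div_sub_center_pow_smul hR n
  simp only [smul_eq_mul, one_div_mul_eq_div] at hcauchy
  rw [laurentCoeff, ← Nat.cast_add_one]
  simp only [zpow_natCast]
  rw [hcauchy, div_mul_eq_mul_div, mul_div_assoc, inv_mul_cancel_left₀ Complex.two_pi_I_ne_zero,
    div_eq_inv_mul]

theorem laurentCoeff_of_neg (hR : 0 < R) (hf : DifferentiableOn ℂ f (closedBall c R)) {k : ℤ}
    (hk : k < 0) : laurentCoeff f c R k = 0 := by
  obtain ⟨n, hn⟩ := Int.exists_eq_neg_ofNat (Int.add_one_le_of_lt hk)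
  have hholo : DifferentiableOn ℂ (fun s => f s * (s - c) ^ n) (closedBall c R) :=
    hf.mul (by fun_prop)
  rw [laurentCoeff, hn]
  simp only [zpow_neg, zpow_natCast, div_inv_eq_mul]
  rw [(hholo.diffContOnCl_ball subset_rfl).circleIntegral_eq_zero hR.le, mul_zero]

theorem hasSum_laurentCoeff_of_eq_div {r : ℝ} (hR : 0 < R) (hRr : R < r)
    (hg : DifferentiableOn ℂ g (ball c r)) (hf : ∀ s ∈ ball c r, s ≠ c → f s = g s / (s - c))
    {s : ℂ} (hs : s ∈ ball c r) (hsc : s ≠ c) :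
    HasSum (fun n : ℕ => laurentCoeff f c R ((n : ℤ) - 1) * (s - c) ^ ((n : ℤ) - 1)) (f s) := by
  have hsc' : s - c ≠ 0 := sub_ne_zero.2 hsc
  have htaylor := (Complex.hasSum_taylorSeries_on_ball hg hs).div_const (s - c)
  rw [← hf s hs hsc] at htaylor
  refine htaylor.congr_fun fun n => ?_
  have hsphere : ∀ z ∈ sphere c R, f z = g z / (z - c) := fun z hz =>
    hf z (sphere_subset_ball hRr hz) (ne_of_mem_sphere hz hR.ne')
  rw [laurentCoeff_of_eq_div hR hsphere, sub_add_cancel,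
    laurentCoeff_natCast hR (hg.mono (closedBall_subset_ball hRr)), zpow_sub_one₀ hsc',
    zpow_natCast, smul_eq_mul, smul_eq_mul]
  ring

theorem laurentCoeff_add_center (f : ℂ → ℂ) (c a : ℂ) (R : ℝ) (k : ℤ) :
    laurentCoeff f (c + a) R k = laurentCoeff (fun s => f (s + a)) c R k := by
  have hmap : ∀ θ, circleMap (c + a) R θ = circleMap c R θ + a := fun θ => add_right_comm _ _ _
  simp only [laurentCoeff, circleIntegral, deriv_circleMap, hmap, add_sub_add_right_eq_sub]

theorem laurentCoeff_const_sub_mul (hR : 0 < R) (hf : ContinuousOn f (sphere c R)) (e : ℂ)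
    (k : ℤ) : laurentCoeff (fun s => (e - s) * f s) c R k =
      (e - c) * laurentCoeff f c R k - laurentCoeff f c R (k - 1) := by
  have hint : ∀ j : ℤ, CircleIntegrable (fun s => f s / (s - c) ^ j) c R := fun j =>
    (hf.div (ContinuousOn.zpow₀ (by fun_prop) j
      fun s hs => Or.inl (sub_ne_zero_of_mem_sphere hR hs)) fun s hs =>
        zpow_ne_zero j (sub_ne_zero_of_mem_sphere hR hs)).circleIntegrable hR.le
  have hint_mul : CircleIntegrable (fun s => (e - c) * (f s / (s - c) ^ (k + 1))) c R :=
    (hint (k + 1)).const_smul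
  have hsplit : ∀ s ∈ sphere c R, (e - s) * f s / (s - c) ^ (k + 1) =
      (e - c) * (f s / (s - c) ^ (k + 1)) - f s / (s - c) ^ k := fun s hs => by
    have hs0 := sub_ne_zero_of_mem_sphere hR hs
    have hsk := zpow_ne_zero k hs0
    rw [zpow_add_one₀ hs0]
    field_simp
    ring
  rw [laurentCoeff, circleIntegral.integral_congr hR.le hsplit,
    circleIntegral.integral_sub hint_mul (hint k), circleIntegral.integral_const_mul,
    laurentCoeff, laurentCoeff, sub_add_cancel]
  ring

namespace IsLadder

variable {e : ℂ} {U : Set ℂ} {F : ℂ → ℝ → ℂ}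

theorem hasDerivAt_laurentCoeff (h : IsLadder e U F) (hR : 0 < R) (hc : sphere c R ⊆ U)
    (hc1 : sphere (c + 1) R ⊆ U) (k : ℤ) {x : ℝ} (hx : 0 < x) :
    HasDerivAt (fun y => laurentCoeff (fun s => F s y) c R k)
      ((e - c) * laurentCoeff (fun s => F s x) (c + 1) R k -
        laurentCoeff (fun s => F s x) (c + 1) R (k - 1)) x := by
  have hshift : ∀ s ∈ sphere c R, s + 1 ∈ U := fun s hs =>
    hc1 (by simpa only [mem_sphere, dist_add_right] using hs)
  have hzpow : ContinuousOn (fun s => (s - c) ^ (k + 1)) (sphere c R) :=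
    ContinuousOn.zpow₀ (by fun_prop) _ fun s hs => Or.inl (sub_ne_zero_of_mem_sphere hR hs)
  have hzpow_ne : ∀ s ∈ sphere c R, (s - c) ^ (k + 1) ≠ 0 := fun s hs =>
    zpow_ne_zero _ (sub_ne_zero_of_mem_sphere hR hs)
  have hcont : ContinuousOn (fun s => F (s + 1) x) (sphere c R) :=
    (h.continuousOn_left hx).comp (by fun_prop) hshift
  rw [laurentCoeff_add_center, laurentCoeff_add_center, ← laurentCoeff_const_sub_mul hR hcont]
  refine (hasDerivAt_circleIntegral_of_continuousOn hR.le isOpen_Ioi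
    (f' := fun s y => (e - s) * F (s + 1) y / (s - c) ^ (k + 1)) (fun y hy => ?_) ?_
    (fun s hs y hy => (h.hasDerivAt s (hc hs) (hshift s hs) y hy).div_const _)
    (mem_Ioi.2 hx)).const_mul _
  · exact ((h.continuousOn_left hy).mono hc).div hzpow hzpow_ne
  · refine ContinuousOn.div (ContinuousOn.mul (by fun_prop) ?_)
      (hzpow.comp continuousOn_fst fun p hp => hp.1) fun p hp => hzpow_ne _ hp.1
    exact h.continuousOn.comp (f := fun p : ℂ × ℝ => (p.1 + 1, p.2)) (by fun_prop)
      fun p hp => ⟨hshift _ hp.1, hp.2⟩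

theorem contDiffOn_laurentCoeff (h : IsLadder e U F) (hR : 0 < R)
    (hc : ∀ j : ℕ, sphere (c + j) R ⊆ U) (k : ℤ) (n : ℕ) :
    ContDiffOn ℝ n (fun x => laurentCoeff (fun s => F s x) c R k) (Ioi 0) := by
  induction n generalizing c k with
  | zero =>
    rw [Nat.cast_zero, contDiffOn_zero]
    exact fun x hx => (h.hasDerivAt_laurentCoeff hR (by simpa using hc 0) (by simpa using hc 1) k
      hx).continuousAt.continuousWithinAt
  | succ n ih =>
    have hderiv : ∀ x ∈ Ioi 0, HasDerivAt (fun y => laurentCoeff (fun s => F s y) c R k) _ x :=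
      fun x hx => h.hasDerivAt_laurentCoeff hR (by simpa using hc 0) (by simpa using hc 1) k hx
    have hc1 : ∀ j : ℕ, sphere (c + 1 + j) R ⊆ U := fun j => by
      have := hc (j + 1)
      rwa [Nat.cast_succ, add_comm (j : ℂ), ← add_assoc] at this
    rw [Nat.cast_succ, contDiffOn_succ_iff_deriv_of_isOpen isOpen_Ioi]
    refine ⟨fun x hx => (hderiv x hx).differentiableAt.differentiableWithinAt, by simp, ?_⟩
    exact ((contDiffOn_const.mul (ih hc1 k)).sub (ih hc1 (k - 1))).congr fun x hx =>
      (hderiv x hx).deriv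

end IsLadder

end LaurentCoeff

section BarnesZeta

theorem isOpen_compl_one_two : IsOpen ({1, 2}ᶜ : Set ℂ) :=
  (toFinite {1, 2}).isClosed.isOpen_compl

theorem isPreconnected_compl_one_two : IsPreconnected ({1, 2}ᶜ : Set ℂ) :=
  ((toFinite {1, 2}).countable.isConnected_compl_of_one_lt_rank (by simp)).isPreconnected

theorem natCast_notMem_sphere_natCast_half (m n : ℕ) : (m : ℂ) ∉ sphere (n : ℂ) (1 / 2) := by
  intro h
  rw [mem_sphere_iff_norm, ← Int.cast_natCast m, ← Int.cast_natCast n, ← Int.cast_sub,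
    Complex.norm_intCast, eq_div_iff two_ne_zero] at h
  have : |(m - n : ℤ)| * 2 = 1 := by exact_mod_cast h
  lia

theorem sphere_natCast_half_subset (n : ℕ) : sphere (n : ℂ) (1 / 2) ⊆ {1, 2}ᶜ := by
  rintro s hs (rfl | rfl)
  · exact natCast_notMem_sphere_natCast_half 1 n (by exact_mod_cast hs)
  · exact natCast_notMem_sphere_natCast_half 2 n (by exact_mod_cast hs)

namespace IsBarnesContinuation

variable {α v w : ℝ} {Z Z' : ℂ → ℂ}

theorem eqOn (h : IsBarnesContinuation α v w Z) (h' : IsBarnesContinuation α v w Z') :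
    EqOn Z Z' {1, 2}ᶜ :=
  eqOn_of_eqOn_re_gt isOpen_compl_one_two isPreconnected_compl_one_two
    ⟨3, by norm_num, by norm_num⟩ h.1 h'.1 fun s hs => (h.2 s hs).unique (h'.2 s hs)

theorem conj (hα : 0 < α) (hv : 0 < v) (hw : 0 < w) (h : IsBarnesContinuation α v w Z) :
    IsBarnesContinuation α v w (starRingEnd ℂ ∘ Z ∘ starRingEnd ℂ) := by
  refine ⟨fun s hs => ?_, fun s hs => ?_⟩
  · have hs' : starRingEnd ℂ s ∈ ({1, 2}ᶜ : Set ℂ) := by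
      simp only [mem_compl_iff, mem_insert_iff, mem_singleton_iff, not_or] at hs ⊢
      rwa [← map_one (starRingEnd ℂ), ← Complex.conj_ofNat, (starRingEnd ℂ).injective.eq_iff,
        (starRingEnd ℂ).injective.eq_iff]
    have hd := (h.1.differentiableAt (isOpen_compl_one_two.mem_nhds hs')).conj_conj
    rw [Complex.conj_conj] at hd
    exact hd.differentiableWithinAt
  · refine ((h.2 (starRingEnd ℂ s) (by rwa [Complex.conj_re])).map (starRingEnd ℂ)
      Complex.continuous_conj).congr_fun fun p => ?_
    have hp : 0 ≤ α + p.1 * v + p.2 * w := by positivity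
    have harg : ((α + p.1 * v + p.2 * w : ℝ) : ℂ).arg ≠ Real.pi := by
      rw [Complex.arg_ofReal_of_nonneg hp]
      exact Real.pi_pos.ne
    rw [Function.comp_apply, map_div₀, map_one, Complex.cpow_conj _ _ harg, Complex.conj_ofReal,
      Complex.conj_conj]

end IsBarnesContinuation

theorem IsRegularization.isBarnesContinuation {v w : ℝ} {G : ℂ → ℝ → ℂ}
    (hG : IsRegularization (addMultiples (addMultiples (fun _ : Unit => 0) v) w) 2 G) {α : ℝ}
    (hα : 0 < α) : IsBarnesContinuation α v w (fun s => G s α / ((s - 1) * (s - 2))) := by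
  refine ⟨?_, fun s hs => ?_⟩
  · refine ((hG.isLadder.differentiableOn α hα).mono (subset_univ _)).div (by fun_prop)
      fun s hs => ?_
    simp only [mem_compl_iff, mem_insert_iff, mem_singleton_iff, not_or] at hs
    exact mul_ne_zero (sub_ne_zero.2 hs.1) (sub_ne_zero.2 hs.2)
  · have hs1 : s - 1 ≠ 0 := sub_ne_zero.2 (by rintro rfl; norm_num at hs)
    have hs2 : s - 2 ≠ 0 := sub_ne_zero.2 (by rintro rfl; norm_num at hs)
    have hs' : ((2 : ℕ) : ℝ) < s.re := by exact_mod_cast hs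
    simp only [hG.eq_regularizedSeries s hs' α hα, regularizedSeries, poleFactor_two]
    rw [mul_div_cancel_left₀ _ (mul_ne_zero hs1 hs2),
      ← ((Equiv.punitProd ℕ).prodCongr (Equiv.refl ℕ)).hasSum_iff]
    refine (hG.hasAbscissaLE.summable_cpow hs' hα).hasSum.congr_fun fun p => ?_
    simp [addMultiples, Complex.cpow_neg, add_assoc]

variable {α v w : ℝ}

theorem isBarnesContinuation_barnesZeta (hα : 0 < α) (hv : 0 < v) (hw : 0 < w) :
    IsBarnesContinuation α v w (fun s => barnesZeta s α v w) := by
  obtain ⟨G, hG, -⟩ := exists_isRegularization_two hv hw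
  have hex : ∃ Z, IsBarnesContinuation α v w Z := ⟨_, hG.isBarnesContinuation hα⟩
  simp only [barnesZeta, dif_pos hex]
  exact hex.choose_spec

theorem exists_barnesZeta_eq_div (hv : 0 < v) (hw : 0 < w) :
    ∃ G : ℂ → ℝ → ℂ, IsLadder 2 univ G ∧
      (∀ s ∈ ({1, 2}ᶜ : Set ℂ), ∀ x, 0 < x →
        barnesZeta s x v w = G s x / ((s - 1) * (s - 2))) ∧
      ∀ x : ℝ, 0 < x → G 1 x = (2 * x - v - w) / (2 * v * w) := by
  obtain ⟨G, hG, hG1⟩ := exists_isRegularization_two hv hw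
  exact ⟨G, hG.isLadder, fun s hs x hx => (isBarnesContinuation_barnesZeta hx hv hw).eqOn
    (hG.isBarnesContinuation hx) hs, hG1⟩

theorem isLadder_barnesZeta (hv : 0 < v) (hw : 0 < w) :
    IsLadder 0 {1, 2}ᶜ (fun s x => barnesZeta s x v w) := by
  obtain ⟨G, hG, hζ, -⟩ := exists_barnesZeta_eq_div hv hw
  have hne : ∀ s ∈ ({1, 2}ᶜ : Set ℂ), s - 1 ≠ 0 ∧ s - 2 ≠ 0 := fun s hs => by
    simpa only [mem_compl_iff, mem_insert_iff, mem_singleton_iff, not_or, sub_ne_zero] using hs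
  refine ((hG.mono (subset_univ _)).mul_left (c' := 0) (p := fun s => ((s - 1) * (s - 2))⁻¹)
    ?_ fun s hs hs1 => ?_).congr fun s hs x hx => ?_
  · exact DifferentiableOn.inv (by fun_prop) fun s hs => mul_ne_zero (hne s hs).1 (hne s hs).2
  · obtain ⟨h1, h2⟩ := hne s hs
    obtain ⟨h0, -⟩ := hne (s + 1) hs1
    rw [add_sub_cancel_right] at h0
    rw [add_sub_cancel_right, show s + 1 - 2 = s - 1 by ring]
    field_simp
    ring
  · rw [hζ s hs x hx, div_eq_inv_mul]

theorem exists_barnesZeta_eq_div_sub_one (hα : 0 < α) (hv : 0 < v) (hw : 0 < w) :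
    ∃ g : ℂ → ℂ, DifferentiableOn ℂ g (ball 1 1) ∧
      (∀ s ∈ ball (1 : ℂ) 1, s ≠ 1 → barnesZeta s α v w = g s / (s - 1)) ∧
      g 1 = ((v + w - 2 * α) / (2 * v * w) : ℝ) := by
  obtain ⟨G, hG, hζ, hG1⟩ := exists_barnesZeta_eq_div hv hw
  have hne : ∀ s ∈ ball (1 : ℂ) 1, s ≠ 2 := by
    rintro _ hs rfl
    rw [mem_ball_iff_norm] at hs
    norm_num at hs
  refine ⟨fun s => G s α / (s - 2), ?_, fun s hs hs1 => ?_, ?_⟩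
  · exact ((hG.differentiableOn α hα).mono (subset_univ _)).div (by fun_prop)
      fun s hs => sub_ne_zero.2 (hne s hs)
  · rw [hζ s (by simp [hs1, hne s hs]) α hα, div_div, mul_comm]
  · simp only [hG1 α hα]
    push_cast
    ring

theorem exists_barnesZeta_eq_div_sub_two (hα : 0 < α) (hv : 0 < v) (hw : 0 < w) :
    ∃ g : ℂ → ℂ, DifferentiableOn ℂ g (ball 2 1) ∧
      ∀ s ∈ ball (2 : ℂ) 1, s ≠ 2 → barnesZeta s α v w = g s / (s - 2) := by
  obtain ⟨G, hG, hζ, -⟩ := exists_barnesZeta_eq_div hv hw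
  have hne : ∀ s ∈ ball (2 : ℂ) 1, s ≠ 1 := by
    rintro _ hs rfl
    rw [mem_ball_iff_norm] at hs
    norm_num at hs
  refine ⟨fun s => G s α / (s - 1), ?_, fun s hs hs2 => ?_⟩
  · exact ((hG.differentiableOn α hα).mono (subset_univ _)).div (by fun_prop)
      fun s hs => sub_ne_zero.2 (hne s hs)
  · rw [hζ s (by simp [hs2, hne s hs]) α hα, div_div]

theorem log_doubleGamma (hα : 0 < α) (hv : 0 < v) (hw : 0 < w) :
    Complex.log (doubleGamma α v w) = logDoubleGamma α v w := by
  have hζ := isBarnesContinuation_barnesZeta hα hv hw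
  have hderiv := (((hζ.conj hα hv hw).eqOn hζ).eventuallyEq_of_mem
    (isOpen_compl_one_two.mem_nhds (x := 0) (by norm_num))).deriv_eq
  rw [deriv_conj_conj, Function.comp_apply, Function.comp_apply, map_zero] at hderiv
  have him : (logDoubleGamma α v w).im = 0 := Complex.conj_eq_iff_im.1 hderiv
  rw [doubleGamma, Complex.log_exp] <;> rw [him] <;> linarith [Real.pi_pos]

end BarnesZeta

section LaurentCoefficients

theorem sum_Icc_neg_one_zpow_mul_add {K : Type*} [Field K] (a : ℤ → K) {m k : ℤ} (hk : m - 1 ≤ k) :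
    ∑ l ∈ Finset.Icc m k, (-1) ^ (k - l) * (a l + a (l - 1)) =
      a k - (-1) ^ (k - (m - 1)) * a (m - 1) := by
  induction k, hk using Int.leInduction with
  | base => simp
  | succ k hk ih =>
    have hpow : ∀ j : ℤ, (-1 : K) ^ (k + 1 - j) = -(-1) ^ (k - j) := fun j => by
      rw [add_sub_right_comm, zpow_add_one₀ (neg_ne_zero.2 one_ne_zero), mul_neg_one]
    have hIcc : Finset.Icc m (k + 1) = insert (k + 1) (Finset.Icc m k) := by
      ext l
      simp only [Finset.mem_Icc, Finset.mem_insert]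
      lia
    rw [hIcc, Finset.sum_insert (by simp)]
    simp only [hpow, neg_mul, Finset.sum_neg_distrib]
    rw [ih, add_sub_cancel_right, sub_add_cancel_left, zpow_neg_one, inv_neg_one]
    ring

variable {α v w : ℝ}

theorem barnesGamma_eq_laurentCoeff (k : ℤ) (c : ℂ) (α v w : ℝ) :
    barnesGamma k c α v w = laurentCoeff (fun s => barnesZeta s α v w) c (1 / 2) k :=
  rfl

theorem hasSum_barnesGamma_one (hα : 0 < α) (hv : 0 < v) (hw : 0 < w) {s : ℂ}
    (hs0 : 0 < ‖s - 1‖) (hs1 : ‖s - 1‖ < 1) :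
    HasSum (fun n : ℕ => barnesGamma ((n : ℤ) - 1) 1 α v w * (s - 1) ^ ((n : ℤ) - 1))
      (barnesZeta s α v w) := by
  obtain ⟨g, hg, hζ, -⟩ := exists_barnesZeta_eq_div_sub_one hα hv hw
  exact hasSum_laurentCoeff_of_eq_div one_half_pos one_half_lt_one hg hζ
    (mem_ball_iff_norm.2 hs1) (norm_sub_pos_iff.1 hs0)

theorem hasSum_barnesGamma_two (hα : 0 < α) (hv : 0 < v) (hw : 0 < w) {s : ℂ}
    (hs0 : 0 < ‖s - 2‖) (hs1 : ‖s - 2‖ < 1) :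
    HasSum (fun n : ℕ => barnesGamma ((n : ℤ) - 1) 2 α v w * (s - 2) ^ ((n : ℤ) - 1))
      (barnesZeta s α v w) := by
  obtain ⟨g, hg, hζ⟩ := exists_barnesZeta_eq_div_sub_two hα hv hw
  exact hasSum_laurentCoeff_of_eq_div one_half_pos one_half_lt_one hg hζ
    (mem_ball_iff_norm.2 hs1) (norm_sub_pos_iff.1 hs0)

theorem barnesGamma_neg_one_one (hα : 0 < α) (hv : 0 < v) (hw : 0 < w) :
    barnesGamma (-1) 1 α v w = (((v + w - 2 * α) / (2 * v * w) : ℝ) : ℂ) := by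
  obtain ⟨g, hg, hζ, hg1⟩ := exists_barnesZeta_eq_div_sub_one hα hv hw
  have hcoeff := laurentCoeff_natCast one_half_pos
    (hg.mono (closedBall_subset_ball one_half_lt_one)) 0
  rw [Nat.factorial_zero, Nat.cast_one, inv_one, one_mul, iteratedDeriv_zero, hg1] at hcoeff
  rw [barnesGamma_eq_laurentCoeff, ← hcoeff]
  exact laurentCoeff_of_eq_div one_half_pos (fun s hs =>
    hζ s (sphere_subset_ball one_half_lt_one hs) (ne_of_mem_sphere hs one_half_pos.ne')) (-1)

theorem barnesGamma_neg_two_two (hα : 0 < α) (hv : 0 < v) (hw : 0 < w) :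
    barnesGamma (-2) 2 α v w = 0 := by
  obtain ⟨g, hg, hζ⟩ := exists_barnesZeta_eq_div_sub_two hα hv hw
  rw [barnesGamma_eq_laurentCoeff, laurentCoeff_of_eq_div one_half_pos fun s hs =>
    hζ s (sphere_subset_ball one_half_lt_one hs) (ne_of_mem_sphere hs one_half_pos.ne')]
  exact laurentCoeff_of_neg one_half_pos (hg.mono (closedBall_subset_ball one_half_lt_one))
    (by norm_num)

theorem hasDerivAt_laurentCoeff_barnesZeta (hα : 0 < α) (hv : 0 < v) (hw : 0 < w) (n : ℕ) (k : ℤ) :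
    HasDerivAt (fun a => laurentCoeff (fun s => barnesZeta s a v w) n (1 / 2) k)
      (-(n * barnesGamma k (n + 1) α v w + barnesGamma (k - 1) (n + 1) α v w)) α := by
  have hderiv := (isLadder_barnesZeta hv hw).hasDerivAt_laurentCoeff one_half_pos
    (sphere_natCast_half_subset n) (by exact_mod_cast sphere_natCast_half_subset (n + 1)) k hα
  rwa [zero_sub, neg_mul, ← neg_add'] at hderiv

theorem barnesZetaDerivZero_eq (hα : 0 < α) (hv : 0 < v) (hw : 0 < w) (k : ℕ) :
    barnesZetaDerivZero k α v w =
      k.factorial * laurentCoeff (fun s => barnesZeta s α v w) (0 : ℕ) (1 / 2) k := by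
  have hsub : closedBall ((0 : ℕ) : ℂ) (1 / 2) ⊆ {1, 2}ᶜ := by
    rintro s hs (rfl | rfl) <;> norm_num at hs
  rw [laurentCoeff_natCast one_half_pos
    (((isLadder_barnesZeta hv hw).differentiableOn α hα).mono hsub), Nat.cast_zero,
    mul_inv_cancel_left₀ (Nat.cast_ne_zero.2 k.factorial_ne_zero), barnesZetaDerivZero]

theorem hasDerivAt_barnesZetaDerivZero (hα : 0 < α) (hv : 0 < v) (hw : 0 < w) (k : ℕ) :
    HasDerivAt (fun a => barnesZetaDerivZero k a v w)
      (-(k.factorial * barnesGamma ((k : ℤ) - 1) 1 α v w)) α := by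
  have hderiv := ((hasDerivAt_laurentCoeff_barnesZeta hα hv hw 0 k).const_mul
    (k.factorial : ℂ)).congr_of_eventuallyEq
      (eventually_of_mem (Ioi_mem_nhds hα) fun a ha => barnesZetaDerivZero_eq ha hv hw k)
  rwa [Nat.cast_zero, zero_mul, zero_add, zero_add, mul_neg] at hderiv

theorem contDiffOn_barnesZetaDerivZero (hv : 0 < v) (hw : 0 < w) (k n : ℕ) :
    ContDiffOn ℝ n (fun a => barnesZetaDerivZero k a v w) (Ioi 0) := by
  have hcoeff := (isLadder_barnesZeta hv hw).contDiffOn_laurentCoeff one_half_pos (c := (0 : ℕ))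
    (fun j => by exact_mod_cast sphere_natCast_half_subset (0 + j)) k n
  exact ((contDiffOn_const (c := (k.factorial : ℂ))).mul hcoeff).congr fun a ha =>
    barnesZetaDerivZero_eq ha hv hw k

theorem barnesGamma_one_eq_deriv (hα : 0 < α) (hv : 0 < v) (hw : 0 < w) (k : ℕ) :
    barnesGamma ((k : ℤ) - 1) 1 α v w =
      -(1 / (k.factorial : ℂ)) * deriv (fun a => barnesZetaDerivZero k a v w) α := by
  rw [(hasDerivAt_barnesZetaDerivZero hα hv hw k).deriv, neg_mul_neg, one_div,
    inv_mul_cancel_left₀ (Nat.cast_ne_zero.2 k.factorial_ne_zero)]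

theorem hasDerivAt_barnesGamma_one (hα : 0 < α) (hv : 0 < v) (hw : 0 < w) (k : ℤ) :
    HasDerivAt (fun a => barnesGamma k 1 a v w)
      (-(barnesGamma k 2 α v w + barnesGamma (k - 1) 2 α v w)) α := by
  have hderiv := hasDerivAt_laurentCoeff_barnesZeta hα hv hw 1 k
  rwa [Nat.cast_one, one_mul, one_add_one_eq_two] at hderiv

theorem sum_deriv_barnesGamma_one (hα : 0 < α) (hv : 0 < v) (hw : 0 < w) {k : ℤ} (hk : -1 ≤ k) :
    ∑ l ∈ Finset.Icc (-1) k,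
      (-1 : ℂ) ^ (k - l + 1) * deriv (fun a => barnesGamma l 1 a v w) α =
        barnesGamma k 2 α v w := by
  have hsum := sum_Icc_neg_one_zpow_mul_add (fun l => barnesGamma l 2 α v w) (m := -1) (k := k)
    (by lia)
  rw [show (-1 - 1 : ℤ) = -2 by norm_num, barnesGamma_neg_two_two hα hv hw, mul_zero,
    sub_zero] at hsum
  rw [← hsum]
  refine Finset.sum_congr rfl fun l _ => ?_
  rw [(hasDerivAt_barnesGamma_one hα hv hw l).deriv,
    zpow_add_one₀ (neg_ne_zero.2 one_ne_zero), mul_neg_one, neg_mul_neg]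

theorem logDoubleGamma_eq (α v w : ℝ) : logDoubleGamma α v w = barnesZetaDerivZero 1 α v w := by
  rw [barnesZetaDerivZero, iteratedDeriv_one, logDoubleGamma]

theorem hasDerivAt_logDoubleGamma (hα : 0 < α) (hv : 0 < v) (hw : 0 < w) :
    HasDerivAt (fun a => logDoubleGamma a v w) (-barnesGamma 0 1 α v w) α := by
  have hderiv := hasDerivAt_barnesZetaDerivZero hα hv hw 1
  simp only [← logDoubleGamma_eq] at hderiv
  rwa [Nat.factorial_one, Nat.cast_one, one_mul, Nat.cast_one, sub_self] at hderiv

theorem contDiffOn_logDoubleGamma (hv : 0 < v) (hw : 0 < w) (n : ℕ) :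
    ContDiffOn ℝ n (fun a => logDoubleGamma a v w) (Ioi 0) := by
  simp only [logDoubleGamma_eq]
  exact contDiffOn_barnesZetaDerivZero hv hw 1 n

theorem differentiableAt_doublePolygamma (hα : 0 < α) (hv : 0 < v) (hw : 0 < w) (k : ℕ) :
    DifferentiableAt ℝ (fun a => doublePolygamma k a v w) α := by
  have hdiff := (contDiffOn_logDoubleGamma hv hw (k + 1)).differentiableOn_iteratedDerivWithin
    (m := k) (by exact_mod_cast k.lt_succ_self) isOpen_Ioi.uniqueDiffOn
  exact (hdiff.congr fun a ha =>
    (iteratedDerivWithin_of_isOpen isOpen_Ioi ha).symm).differentiableAt (Ioi_mem_nhds hα)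

theorem iteratedDeriv_barnesGamma_zero_one (hα : 0 < α) (hv : 0 < v) (hw : 0 < w) (k : ℕ) :
    iteratedDeriv k (fun a => barnesGamma 0 1 a v w) α =
      -deriv (fun a => doublePolygamma k a v w) α := by
  have hderiv : (fun a => barnesGamma 0 1 a v w) =ᶠ[𝓝 α] -deriv fun a => logDoubleGamma a v w :=
    eventually_of_mem (Ioi_mem_nhds hα) fun a ha => by
      rw [Pi.neg_apply, (hasDerivAt_logDoubleGamma ha hv hw).deriv, neg_neg]
  rw [hderiv.iteratedDeriv_eq, iteratedDeriv_neg, ← iteratedDeriv_succ', iteratedDeriv_succ]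
  rfl

end LaurentCoefficients

theorem theorem2 (α v w : ℝ) (hα : 0 < α) (hv : 0 < v) (hw : 0 < w) :
    -- `ζ₂` is the analytic continuation of the double series
    IsBarnesContinuation α v w (fun s => barnesZeta s α v w) ∧
    -- the Laurent expansions at `s = 1` and `s = 2`
    (∀ s : ℂ, 0 < ‖s - 1‖ → ‖s - 1‖ < 1 →
      HasSum (fun n : ℕ => barnesGamma ((n : ℤ) - 1) 1 α v w * (s - 1) ^ ((n : ℤ) - 1))
        (barnesZeta s α v w)) ∧
    (∀ s : ℂ, 0 < ‖s - 2‖ → ‖s - 2‖ < 1 →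
      HasSum (fun n : ℕ => barnesGamma ((n : ℤ) - 1) 2 α v w * (s - 2) ^ ((n : ℤ) - 1))
        (barnesZeta s α v w)) ∧
    -- the coefficients at `s = 1` from those at `s = 0`
    (∀ k : ℕ,
      DifferentiableAt ℝ (fun a : ℝ => barnesZetaDerivZero k a v w) α ∧
      barnesGamma ((k : ℤ) - 1) 1 α v w
        = -(1 / (k.factorial : ℂ)) * deriv (fun a : ℝ => barnesZetaDerivZero k a v w) α) ∧
    barnesGamma (-1) 1 α v w = (((v + w - 2 * α) / (2 * v * w) : ℝ) : ℂ) ∧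
    -- the double gamma and polygamma functions
    Complex.log (doubleGamma α v w) = logDoubleGamma α v w ∧
    (DifferentiableAt ℝ (fun a : ℝ => logDoubleGamma a v w) α ∧
      barnesGamma 0 1 α v w = -deriv (fun a : ℝ => logDoubleGamma a v w) α) ∧
    (∀ k : ℕ,
      DifferentiableAt ℝ (fun a : ℝ => doublePolygamma k a v w) α ∧
      iteratedDeriv k (fun a : ℝ => barnesGamma 0 1 a v w) α
        = -deriv (fun a : ℝ => doublePolygamma k a v w) α) ∧
    -- the coefficients at `s = 2` from those at `s = 1`
    (∀ k : ℤ, -1 ≤ k →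
      DifferentiableAt ℝ (fun a : ℝ => barnesGamma k 1 a v w) α ∧
      ∑ l ∈ Finset.Icc (-1) k,
          (-1 : ℂ) ^ (k - l + 1) * deriv (fun a : ℝ => barnesGamma l 1 a v w) α
        = barnesGamma k 2 α v w) :=
  ⟨isBarnesContinuation_barnesZeta hα hv hw,
    fun _ => hasSum_barnesGamma_one hα hv hw,
    fun _ => hasSum_barnesGamma_two hα hv hw,
    fun k => ⟨(hasDerivAt_barnesZetaDerivZero hα hv hw k).differentiableAt,
      barnesGamma_one_eq_deriv hα hv hw k⟩,
    barnesGamma_neg_one_one hα hv hw,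
    log_doubleGamma hα hv hw,
    ⟨(hasDerivAt_logDoubleGamma hα hv hw).differentiableAt,
      by rw [(hasDerivAt_logDoubleGamma hα hv hw).deriv, neg_neg]⟩,
    fun k => ⟨differentiableAt_doublePolygamma hα hv hw k,
      iteratedDeriv_barnesGamma_zero_one hα hv hw k⟩,
    fun k hk => ⟨(hasDerivAt_barnesGamma_one hα hv hw k).differentiableAt,
      sum_deriv_barnesGamma_one hα hv hw hk⟩⟩
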